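/- Let $K$ be a field, $S=K[x_1,\dots,x_n]$, and let $I=P_{F_1}P_{F_2}\cdots P_{F_r}\subset S$ be a transversal polymatroidal ideal, where $r\ge 1$, $F_1,\dots,F_r$ are non-empty subsets of $\{1,\dots,n\}$ and $P_F=(x_i : i\in F)$. Let $G_I$ be the graph on $\{1,\dots,r\}$ in which $d\ne e$ are adjacent if and only if $F_d\cap F_e\neq\emptyset$; for a subgraph $\mathcal H$ of $G_I$ with vertex set $\mathcal V(\mathcal H)$ put $P_{\mathcal H}=\sum_{d\in \mathcal V(\mathcal H)}P_{F_d}$. Let $m_1,\dots,m_n\ge 1$, let $T=K[x_{ij} : 1\le i\le n,\ 1\le j\le m_i]$, and let $L_{i,a}$ ($1\le i\le n$, $a\ge 0$) be ideals of $T$ with $L_{i,0}=T$, $L_{i,1}=(x_{i1},\dots,x_{im_i})$ and $L_{i,a+b}=L_{i,a}L_{i,b}$ for all $a,b\ge 0$. Let $$L=\sum_{x_1^{a_1}\cdots x_n^{a_n}\in G(I)}\ \prod_{i=1}^n L_{i,a_i}\subset T$$ be the generalized mixed product ideal induced by $I$, where $G(I)$ is the set of minimal monomial generators of $I$. For a subgraph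 $\mathcal H$ of $G_I$ put $P'_{\mathcal H}=\sum_{d\in\mathcal V(\mathcal H)}\sum_{i\in F_d}L_{i,1}\subset T$. Let $\mathrm{Ass}_S(S/I)=\{P_1,\dots,P_q\}$ with $P_1,\dots,P_q$ pairwise distinct. Then for each $h=1,\dots,q$ there is a subgraph $\mathcal T_h$ of $G_I$ that is maximal (with respect to inclusion) among the subgraphs $\mathcal T$ of $G_I$ that are trees and satisfy $P_{\mathcal T}=P_h$. For every choice of such maximal trees $\mathcal T_1,\dots,\mathcal T_q$, with $a_h=|\mathcal V(\mathcal T_h)|$ and $P'_h=P'_{\mathcal T_h}$, and for every $k\ge 1$, $$L^k=\bigcap_{h=1}^q (P'_h)^{k a_h}$$ is an irredundant primary decomposition: each $(P'_h)^{ka_h}$ is primary, their radicals are pairwise distinct, and none of them can be omitted from the intersection. -/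

import Mathlib

noncomputable section

namespace MixedProduct

/-- The polynomial ring `S = K[x_1, …, x_n]`. -/
abbrev BaseRing (K : Type*) [Field K] (n : ℕ) : Type _ := MvPolynomial (Fin n) K

/-- The polynomial ring `T = K[x_{ij} : 1 ≤ i ≤ n, 1 ≤ j ≤ m_i]`. -/
abbrev BlockRing (K : Type*) [Field K] {n : ℕ} (m : Fin n → ℕ) : Type _ :=
  MvPolynomial (Σ i : Fin n, Fin (m i)) K

/-- The exponent vectors of the minimal monomial generators `G(I)` of a monomial ideal `I`:
the vectors that are minimal, for divisibility, among those of the monomials in `I`. -/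
def minGenExponents {K : Type*} [Field K] {n : ℕ} (I : Ideal (BaseRing K n)) :
    Set (Fin n →₀ ℕ) :=
  {a | Minimal (fun b : Fin n →₀ ℕ => MvPolynomial.monomial b (1 : K) ∈ I) a}

/-- The generalized mixed product ideal induced by `I` and the family `L_{i,a}` of ideals of `T`:
the sum, over the minimal generators `x^a` of `I`, of the products `∏ i, L_{i,a(i)}`. -/
def mixedProductIdeal {K : Type*} [Field K] {n : ℕ} {m : Fin n → ℕ}
    (I : Ideal (BaseRing K n)) (L : Fin n → ℕ → Ideal (BlockRing K m)) :
    Ideal (BlockRing K m) :=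
  ⨆ a ∈ minGenExponents I, ∏ i, L i (a i)

/-- The ideal `(x_{i1}, …, x_{i m_i})` of `T`. -/
def blockIdeal (K : Type*) [Field K] {n : ℕ} (m : Fin n → ℕ) (i : Fin n) :
    Ideal (BlockRing K m) :=
  Ideal.span (Set.range fun j : Fin (m i) =>
    (MvPolynomial.X (⟨i, j⟩ : Σ i : Fin n, Fin (m i)) : BlockRing K m))

/-- The monomial prime `P_F = (x_i : i ∈ F)` of `S`. -/
def primeOf (K : Type*) [Field K] {n : ℕ} (F : Finset (Fin n)) : Ideal (BaseRing K n) :=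
  Ideal.span ((fun i => (MvPolynomial.X i : BaseRing K n)) '' (F : Set (Fin n)))

/-- The ideal `P'_F = ∑_{i ∈ F} (x_{i1}, …, x_{i m_i})` of `T`. -/
def primeOf' (K : Type*) [Field K] {n : ℕ} (m : Fin n → ℕ) (F : Finset (Fin n)) :
    Ideal (BlockRing K m) :=
  ⨆ i ∈ F, blockIdeal K m i

/-- The transversal polymatroidal ideal `I = P_{F_1} ⋯ P_{F_r}`. -/
def transversalIdeal (K : Type*) [Field K] {n r : ℕ} (F : Fin r → Finset (Fin n)) :
    Ideal (BaseRing K n) :=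
  ∏ d, primeOf K (F d)

/-- The graph `G_I` on `{1, …, r}`: distinct `d`, `e` are adjacent iff `F_d ∩ F_e ≠ ∅`. -/
def intersectionGraph {n r : ℕ} (F : Fin r → Finset (Fin n)) : SimpleGraph (Fin r) where
  Adj d e := d ≠ e ∧ (F d ∩ F e).Nonempty
  symm := ⟨fun _ _ h => ⟨h.1.symm, by rw [Finset.inter_comm]; exact h.2⟩⟩
  loopless := ⟨fun _ h => h.1 rfl⟩

/-- `P_H = ∑_{d ∈ V(H)} P_{F_d}` for a subgraph `H` of `G_I`. -/
def primeOfSubgraph (K : Type*) [Field K] {n r : ℕ} {F : Fin r → Finset (Fin n)}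
    (H : (intersectionGraph F).Subgraph) : Ideal (BaseRing K n) :=
  ⨆ d ∈ H.verts, primeOf K (F d)

/-- `P'_H = ∑_{d ∈ V(H)} P'_{F_d}` for a subgraph `H` of `G_I`. -/
def primeOfSubgraph' (K : Type*) [Field K] {n r : ℕ} (m : Fin n → ℕ)
    {F : Fin r → Finset (Fin n)} (H : (intersectionGraph F).Subgraph) :
    Ideal (BlockRing K m) :=
  ⨆ d ∈ H.verts, primeOf' K m (F d)

/-- `H` is a maximal tree of `G_I` with `P_H = P`: it is maximal (as a subgraph) among the
subgraphs of `G_I` that are trees and have `P` as their associated ideal. -/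
def IsMaximalTreeFor {K : Type*} [Field K] {n r : ℕ} {F : Fin r → Finset (Fin n)}
    (P : Ideal (BaseRing K n)) (H : (intersectionGraph F).Subgraph) : Prop :=
  Maximal (fun H' : (intersectionGraph F).Subgraph =>
    H'.coe.IsTree ∧ primeOfSubgraph K H' = P) H

open Classical in
/-- `J = Q_1 ∩ ⋯ ∩ Q_q` is an irredundant primary decomposition: all `Q_h` are primary, their
radicals are pairwise distinct, and no `Q_h` can be omitted. -/
def IsIrredundantPrimaryDecomposition {R : Type*} [CommRing R] {q : ℕ}
    (J : Ideal R) (Q : Fin q → Ideal R) : Prop :=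
  J = (⨅ h, Q h) ∧ Function.Injective Q ∧
    Submodule.IsMinimalPrimaryDecomposition J (Finset.univ.image Q)

end MixedProduct

end

/-! The ideals `L i a` are forced to be powers of the block ideals, so expanding a product of sums
shows that the induced ideal is again a product of ideals generated by variables, for the blown-up
sets `F' d` of all `(i, j)` with `i ∈ F d`. Everything thus reduces to the powers of such products.

By Hall's theorem a monomial `x^b` lies in `(∏ P_{F_d})^k` iff `k|B| ≤ ∑_{i ∈ F_B} b_i` for every
index set `B`, where `F_B` is the union over `B`; that is, the power is the intersection of all
`P_{F_B}^{k|B|}`. Splitting `B` into connected components, and enlarging each as far as its union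
allows, leaves only the connected flat sets (`hall_of_linked_flat`). None of these is superfluous:
`exists_deficient_exponent` gives a monomial violating exactly one of their inequalities. A flat set
is determined by its union, so the radicals differ.

The case `k = 1` over `S` identifies `Ass(S/I)` with the connected flat sets. A maximal tree for
such a prime spans exactly the corresponding set, since any missing index could be attached as a
leaf (`IsMaximalTreeFor.verts_eq`). Blowing up preserves connectedness and flatness, so the same
sets index the decomposition over `T`. -/

namespace MixedProduct

open MvPolynomial

/-! ### Membership in products and powers of ideals generated by variables. -/

section MonomialIdeals

variable {K σ ι : Type*} [Field K]

/-- The ideal `(x_i : i ∈ U)` generated by a finite set of variables. -/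
noncomputable def varIdeal (K : Type*) [Field K] {σ : Type*} (U : Finset σ) : Ideal (MvPolynomial σ K) :=
  Ideal.span ((fun i => (X i : MvPolynomial σ K)) '' (U : Set σ))

theorem varIdeal_biUnion [DecidableEq σ] (A : Finset ι) (F : ι → Finset σ) :
    varIdeal K (A.biUnion F) = ⨆ d ∈ A, varIdeal K (F d) := by
  simp only [varIdeal, Finset.coe_biUnion, Set.image_iUnion, Ideal.span_iUnion, Finset.mem_coe]

theorem prod_varIdeal [Fintype ι] (F : ι → Finset σ) :
    ∏ d, varIdeal K (F d) = Ideal.span ((fun b => monomial b (1 : K)) ''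
      {b | ∃ c : ι → σ, (∀ d, c d ∈ F d) ∧ ∑ d, Finsupp.single (c d) 1 = b}) := by
  simp only [varIdeal]
  rw [Ideal.prod_span]
  congr 1
  ext f
  simp only [Set.mem_finsetProd, Set.mem_image, Set.mem_ofPred_eq, Finset.mem_coe]
  constructor
  · rintro ⟨g, hg, rfl⟩
    choose c hc hcg using fun d => hg (i := d) (Finset.mem_univ d)
    refine ⟨_, ⟨c, hc, rfl⟩, ?_⟩
    rw [monomial_sum_one]
    exact Finset.prod_congr rfl fun d _ => hcg d
  · rintro ⟨_, ⟨c, hc, rfl⟩, rfl⟩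
    refine ⟨fun d => X (c d), fun {d} _ => ⟨c d, hc d, rfl⟩, ?_⟩
    rw [monomial_sum_one]
    rfl

/-- Rado's form of Hall's theorem, for a multiset of representatives bounded by `b`. -/
theorem exists_sum_single_le_iff [DecidableEq σ] [Fintype ι] (F : ι → Finset σ) (b : σ →₀ ℕ) :
    (∃ c : ι → σ, (∀ d, c d ∈ F d) ∧ ∑ d, Finsupp.single (c d) 1 ≤ b) ↔
      ∀ B : Finset ι, B.card ≤ ∑ i ∈ B.biUnion F, b i := by
  classical
  constructor
  · rintro ⟨c, hc, hcb⟩ B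
    calc B.card = ∑ i ∈ B.biUnion F, (B.filter fun d => c d = i).card :=
          Finset.card_eq_sum_card_fiberwise fun d hd =>
            Finset.mem_biUnion.2 ⟨d, hd, hc d⟩
      _ ≤ ∑ i ∈ B.biUnion F, b i := by
          refine Finset.sum_le_sum fun i _ => le_trans ?_ (hcb i)
          simp only [Finsupp.finsetSum_apply, Finsupp.single_apply, Finset.sum_boole, Nat.cast_id]
          exact Finset.card_le_card (Finset.filter_subset_filter _ (Finset.subset_univ _))
  · intro h
    -- Hall's marriage theorem, with each `i` replaced by `b i` distinct copies.
    have key := (Finset.all_card_le_biUnion_card_iff_exists_injective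
      (fun d => (F d).sigma fun i => Finset.range (b i))).1 fun B => by
        have hB : B.biUnion (fun d => (F d).sigma fun i => Finset.range (b i)) =
            (B.biUnion F).sigma fun i => Finset.range (b i) := by
          ext ⟨i, j⟩
          simp only [Finset.mem_biUnion, Finset.mem_sigma]
          tauto
        rw [hB, Finset.card_sigma]
        simpa using h B
    obtain ⟨g, hg, hgF⟩ := key
    refine ⟨fun d => (g d).1, fun d => (Finset.mem_sigma.1 (hgF d)).1, fun i => ?_⟩
    simp only [Finsupp.finsetSum_apply, Finsupp.single_apply, Finset.sum_boole, Nat.cast_id]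
    rw [← Finset.card_range (b i)]
    refine Finset.card_le_card_of_injOn (fun d => (g d).2) (fun d hd => ?_) fun d hd e he hde => ?_
    · have h1 := (Finset.mem_sigma.1 (hgF d)).2
      have h2 : (g d).1 = i := by simpa using hd
      rw [h2] at h1
      exact h1
    · refine hg (Sigma.ext ?_ (heq_of_eq hde))
      have hd' : (g d).1 = i := by simpa using hd
      have he' : (g e).1 = i := by simpa using he
      rw [hd', he']

theorem mem_prod_varIdeal_iff [DecidableEq σ] [Fintype ι] (F : ι → Finset σ)
    (f : MvPolynomial σ K) :
    f ∈ ∏ d, varIdeal K (F d) ↔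
      ∀ b ∈ f.support, ∀ B : Finset ι, B.card ≤ ∑ i ∈ B.biUnion F, b i := by
  rw [prod_varIdeal, mem_ideal_span_monomial_image]
  refine forall₂_congr fun b _ => ?_
  rw [← exists_sum_single_le_iff]
  constructor
  · rintro ⟨_, ⟨c, hc, rfl⟩, hb⟩
    exact ⟨c, hc, hb⟩
  · rintro ⟨c, hc, hb⟩
    exact ⟨_, ⟨c, hc, rfl⟩, hb⟩

theorem mem_prod_varIdeal_pow_iff [DecidableEq σ] [Fintype ι] (F : ι → Finset σ) (k : ℕ)
    (f : MvPolynomial σ K) :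
    f ∈ (∏ d, varIdeal K (F d)) ^ k ↔
      ∀ b ∈ f.support, ∀ B : Finset ι, k * B.card ≤ ∑ i ∈ B.biUnion F, b i := by
  classical
  -- Each factor is repeated `k` times; among index sets with a given projection `B`, the full
  -- cylinder `B × Fin k` gives the strongest inequality.
  have h : (∏ d, varIdeal K (F d)) ^ k = ∏ p : ι × Fin k, varIdeal K (F p.1) := by
    rw [Fintype.prod_prod_type]
    simp [Finset.prod_pow]
  rw [h, mem_prod_varIdeal_iff (fun p : ι × Fin k => F p.1)]
  refine forall₂_congr fun b _ => ⟨fun h B => ?_, fun h B => ?_⟩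
  · have := h (B ×ˢ Finset.univ)
    rw [Finset.card_product, Finset.card_fin, mul_comm] at this
    refine this.trans (Finset.sum_le_sum_of_subset fun i hi => ?_)
    simp only [Finset.mem_biUnion, Finset.mem_product] at hi ⊢
    obtain ⟨p, hp, hi⟩ := hi
    exact ⟨p.1, hp.1, hi⟩
  · have hc : B.card ≤ k * (B.image Prod.fst).card := by
      rw [mul_comm]
      calc B.card ≤ (B.image Prod.fst ×ˢ (Finset.univ : Finset (Fin k))).card :=
            Finset.card_le_card fun p hp => by
              simp only [Finset.mem_product, Finset.mem_univ, and_true]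
              exact Finset.mem_image_of_mem _ hp
        _ = _ := by rw [Finset.card_product, Finset.card_fin]
    refine (hc.trans (h _)).trans_eq ?_
    rw [Finset.image_biUnion]

theorem mem_varIdeal_pow_iff (U : Finset σ) (k : ℕ) (f : MvPolynomial σ K) :
    f ∈ varIdeal K U ^ k ↔ ∀ b ∈ f.support, k ≤ ∑ i ∈ U, b i := by
  classical
  have h := mem_prod_varIdeal_pow_iff (K := K) (fun _ : Unit => U) k f
  rw [Fintype.prod_unique] at h
  rw [h]
  refine forall₂_congr fun b _ => ⟨fun h => by simpa using h Finset.univ, fun h B => ?_⟩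
  rcases B.eq_empty_or_nonempty with rfl | ⟨⟨⟩, hB⟩
  · simp
  · have : B = {()} := by
      ext x
      simp [hB]
    simpa [this] using h

theorem monomial_mem_varIdeal_pow_iff (U : Finset σ) (k : ℕ) (b : σ →₀ ℕ) :
    monomial b (1 : K) ∈ varIdeal K U ^ k ↔ k ≤ ∑ i ∈ U, b i := by
  classical
  rw [mem_varIdeal_pow_iff, support_monomial, if_neg one_ne_zero]
  simp

theorem X_mem_varIdeal_iff (U : Finset σ) (i : σ) : (X i : MvPolynomial σ K) ∈ varIdeal K U ↔
    i ∈ U := by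
  classical
  rw [← pow_one (varIdeal K U), X, monomial_mem_varIdeal_pow_iff]
  simp [Finsupp.single_apply, Finset.sum_ite_eq, Nat.one_le_iff_ne_zero]

theorem varIdeal_injective : Function.Injective (varIdeal K : Finset σ → _) := fun U V h => by
  ext i
  rw [← X_mem_varIdeal_iff (K := K), h, X_mem_varIdeal_iff]

-- The weighted order is additive on products over a field, so primality of the ideal and
-- primariness of its powers both follow from this form.
open Classical in
theorem mem_varIdeal_pow_iff_le_weightedOrder (U : Finset σ) (k : ℕ) (f : MvPolynomial σ K) :
    f ∈ varIdeal K U ^ k ↔ (k : ℕ∞) ≤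
      (f : MvPowerSeries σ K).weightedOrder fun i => if i ∈ U then 1 else 0 := by
  have hw : ∀ b : σ →₀ ℕ,
      Finsupp.weight (fun i => if i ∈ U then 1 else 0) b = ∑ i ∈ U, b i := fun b => by
    rw [Finsupp.weight_apply, Finsupp.sum]
    simp only [smul_eq_mul, mul_ite, mul_one, mul_zero]
    rw [← Finset.sum_filter, Finset.filter_mem_eq_inter, Finset.inter_comm]
    refine Finset.sum_subset Finset.inter_subset_left fun i hi hi' => ?_
    simpa [hi] using hi'
  rw [mem_varIdeal_pow_iff]
  constructor
  · intro h
    refine MvPowerSeries.nat_le_weightedOrder _ fun b hb => ?_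
    rw [hw] at hb
    rw [coeff_coe]
    by_contra hne
    exact (h b (mem_support_iff.2 hne)).not_gt hb
  · intro h b hb
    have := h.trans (MvPowerSeries.weightedOrder_le (d := b)
      (fun i => if i ∈ U then 1 else 0) (by rw [coeff_coe]; exact mem_support_iff.1 hb))
    rw [hw] at this
    exact_mod_cast this

theorem mem_varIdeal_pow_of_mul_mem {U : Finset σ} {k : ℕ} {f g : MvPolynomial σ K}
    (hfg : f * g ∈ varIdeal K U ^ k) (hg : g ∉ varIdeal K U) : f ∈ varIdeal K U ^ k := by
  classical
  rw [← pow_one (varIdeal K U), mem_varIdeal_pow_iff_le_weightedOrder, Nat.cast_one,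
    Order.one_le_iff_ne_zero, not_not] at hg
  rw [mem_varIdeal_pow_iff_le_weightedOrder] at hfg ⊢
  rwa [coe_mul, MvPowerSeries.weightedOrder_mul, hg, add_zero] at hfg

theorem varIdeal_pow_ne_top (U : Finset σ) {k : ℕ} (hk : k ≠ 0) : varIdeal K U ^ k ≠ ⊤ := by
  rw [Ne, Ideal.eq_top_iff_one, show (1 : MvPolynomial σ K) = monomial 0 1 from rfl, monomial_mem_varIdeal_pow_iff]
  simpa using hk

theorem isPrime_varIdeal (U : Finset σ) : (varIdeal K U).IsPrime := by
  refine ⟨by simpa using varIdeal_pow_ne_top (K := K) U one_ne_zero, fun {f g} h => ?_⟩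
  by_contra! hc
  exact hc.1 (by simpa using mem_varIdeal_pow_of_mul_mem (k := 1) (by simpa using h) hc.2)

theorem radical_varIdeal_pow (U : Finset σ) {k : ℕ} (hk : k ≠ 0) :
    (varIdeal K U ^ k).radical = varIdeal K U := by
  rw [Ideal.radical_pow _ hk, (isPrime_varIdeal U).radical]

theorem isPrimary_varIdeal_pow (U : Finset σ) {k : ℕ} (hk : k ≠ 0) :
    (varIdeal K U ^ k).IsPrimary := by
  refine Ideal.isPrimary_iff.2 ⟨varIdeal_pow_ne_top U hk, fun {f g} h => ?_⟩
  rw [radical_varIdeal_pow U hk]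
  by_contra! hc
  exact hc.1 (mem_varIdeal_pow_of_mul_mem h hc.2)

end MonomialIdeals

end MixedProduct

namespace MixedProduct

open MvPolynomial

/-! ### Connected flat index sets and the decomposition they index. -/

section LinkedFamilies

variable {K σ ι : Type*} [Field K] [DecidableEq σ]

/-- `A` contains the index of every member of the family that is covered by those indexed by `A`. -/
def Flat (F : ι → Finset σ) (A : Finset ι) : Prop :=
  ∀ d, F d ⊆ A.biUnion F → d ∈ A

theorem Flat.eq_of_biUnion_eq {F : ι → Finset σ} {A B : Finset ι} (hA : Flat F A) (hB : Flat F B)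
    (h : A.biUnion F = B.biUnion F) : A = B := by
  refine Finset.Subset.antisymm (fun d hd => hB d ?_) fun d hd => hA d ?_
  · exact h ▸ Finset.subset_biUnion_of_mem F hd
  · exact h ▸ Finset.subset_biUnion_of_mem F hd

variable [DecidableEq ι]

/-- The index sets `A` for which the family `F d`, `d ∈ A`, is connected: they are built from
one index by adjoining indices whose member of the family meets a previous one. -/
inductive Linked (F : ι → Finset σ) : Finset ι → Prop
  | singleton (d : ι) : Linked F {d}
  | adjoin {A : Finset ι} {d e : ι} (hA : Linked F A) (he : e ∉ A) (hd : d ∈ A)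
      (h : (F d ∩ F e).Nonempty) : Linked F (insert e A)

theorem Linked.nonempty {F : ι → Finset σ} {A : Finset ι} (hA : Linked F A) : A.Nonempty := by
  cases hA with
  | singleton d => exact Finset.singleton_nonempty d
  | adjoin _ _ _ _ => exact Finset.insert_nonempty _ _

theorem Linked.mono {τ : Type*} [DecidableEq τ] {F : ι → Finset σ} {F' : ι → Finset τ}
    (h : ∀ d e, (F d ∩ F e).Nonempty → (F' d ∩ F' e).Nonempty) {A : Finset ι}
    (hA : Linked F A) : Linked F' A := by
  induction hA with
  | singleton d => exact .singleton d
  | adjoin _ he hd hde ih => exact .adjoin ih he hd (h _ _ hde)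

/-- A covered non-empty member meets the union, so adjoining its index keeps the set connected and
the union unchanged; a maximal such enlargement is flat. -/
theorem Linked.exists_flat [Fintype ι] {F : ι → Finset σ} (hF : ∀ d, (F d).Nonempty)
    {A : Finset ι} (hA : Linked F A) :
    ∃ B, A ⊆ B ∧ B.biUnion F = A.biUnion F ∧ Linked F B ∧ Flat F B := by
  obtain ⟨B, -, hB⟩ := (Set.toFinite {B : Finset ι | A ⊆ B ∧ B.biUnion F = A.biUnion F ∧
    Linked F B}).exists_le_maximal (a := A) ⟨subset_rfl, rfl, hA⟩
  obtain ⟨h1, h2, h3⟩ := hB.prop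
  refine ⟨B, h1, h2, h3, fun e he => ?_⟩
  by_contra heB
  obtain ⟨i, hi⟩ := hF e
  obtain ⟨d, hd, hid⟩ := Finset.mem_biUnion.1 (he hi)
  refine heB (hB.le_of_ge (y := insert e B) ⟨h1.trans (Finset.subset_insert _ _), ?_,
    h3.adjoin heB hd ⟨i, Finset.mem_inter.2 ⟨hid, hi⟩⟩⟩ (Finset.subset_insert _ _)
    (Finset.mem_insert_self _ _))
  rw [Finset.biUnion_insert, Finset.union_eq_right.2 he, h2]

/-- The inequalities of Hall's condition follow from those for connected flat index sets. -/
theorem hall_of_linked_flat [Fintype ι] {F : ι → Finset σ} (hF : ∀ d, (F d).Nonempty)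
    (k : ℕ) (b : σ → ℕ)
    (h : ∀ A, Linked F A → Flat F A → k * A.card ≤ ∑ i ∈ A.biUnion F, b i) (B : Finset ι) :
    k * B.card ≤ ∑ i ∈ B.biUnion F, b i := by
  induction B using Finset.strongInduction with
  | H B ih =>
    rcases B.eq_empty_or_nonempty with rfl | ⟨d, hd⟩
    · simp
    -- `A` is a connected component of `B`: its union is disjoint from that of `B \ A`, so the
    -- inequalities for the two parts add up.
    obtain ⟨A, -, hA⟩ := (Set.toFinite {A : Finset ι | A ⊆ B ∧ Linked F A}).exists_le_maximal
      (a := {d}) ⟨Finset.singleton_subset_iff.2 hd, .singleton d⟩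
    obtain ⟨hAB, hAl⟩ := hA.prop
    have hdisj : Disjoint (A.biUnion F) ((B \ A).biUnion F) := by
      rw [Finset.disjoint_left]
      intro i hi hi'
      obtain ⟨d, hd, hid⟩ := Finset.mem_biUnion.1 hi
      obtain ⟨e, he, hie⟩ := Finset.mem_biUnion.1 hi'
      rw [Finset.mem_sdiff] at he
      exact he.2 (hA.le_of_ge (y := insert e A) ⟨Finset.insert_subset he.1 hAB,
        hAl.adjoin he.2 hd ⟨i, Finset.mem_inter.2 ⟨hid, hie⟩⟩⟩ (Finset.subset_insert _ _)
        (Finset.mem_insert_self _ _))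
    have hA1 : k * A.card ≤ ∑ i ∈ A.biUnion F, b i := by
      obtain ⟨C, hAC, hCF, hCl, hCf⟩ := hAl.exists_flat hF
      rw [← hCF]
      exact (Nat.mul_le_mul_left k (Finset.card_le_card hAC)).trans (h C hCl hCf)
    have hA2 := ih (B \ A) (Finset.sdiff_ssubset hAB hAl.nonempty)
    rw [← Finset.union_sdiff_of_subset hAB, Finset.union_biUnion, Finset.sum_union hdisj,
      Finset.card_union_of_disjoint Finset.disjoint_sdiff, mul_add]
    exact add_le_add hA1 hA2

/-- A connected family has a vector of degree one less than needed for `k` systems of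
representatives, which suffices for every proper subfamily. -/
theorem Linked.exists_deficient [Fintype σ] {F : ι → Finset σ} (hF : ∀ d, (F d).Nonempty) {k : ℕ}
    (hk : 1 ≤ k) {A : Finset ι} (hA : Linked F A) :
    ∃ b : σ → ℕ, ∑ i, b i < k * A.card ∧ k * A.card ≤ ∑ i ∈ A.biUnion F, b i + 1 ∧
      ∀ B, B ⊂ A → k * B.card ≤ ∑ i ∈ B.biUnion F, b i := by
  induction hA with
  | singleton d =>
    obtain ⟨s, hs⟩ := hF d
    refine ⟨Pi.single s (k - 1), ?_, ?_, fun B hB => ?_⟩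
    · simp
      omega
    · simp [hs]
      omega
    · rw [Finset.ssubset_singleton_iff.1 hB]
      simp
  | @adjoin A d e hA he hd hde ih =>
    obtain ⟨b, hb1, hb2, hb3⟩ := ih
    obtain ⟨s, hs⟩ := hde
    rw [Finset.mem_inter] at hs
    have hadd : ∀ U : Finset σ, s ∈ U →
        ∑ i ∈ U, (b + Pi.single s k : σ → ℕ) i = ∑ i ∈ U, b i + k := fun U hU => by
      simp [Finset.sum_add_distrib, hU]
    have hle : ∀ U : Finset σ, ∑ i ∈ U, b i ≤ ∑ i ∈ U, (b + Pi.single s k : σ → ℕ) i := fun U =>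
      Finset.sum_le_sum fun i _ => Nat.le_add_right _ _
    have hsA : s ∈ A.biUnion F := Finset.mem_biUnion.2 ⟨d, hd, hs.1⟩
    -- The new weight sits at a point common to `F d` and `F e`, so it also serves subfamilies
    -- containing `d` but not `e`.
    refine ⟨b + Pi.single s k, ?_, ?_, fun B hB => ?_⟩
    · rw [hadd _ (Finset.mem_univ s), Finset.card_insert_of_notMem he, mul_add]
      omega
    · rw [hadd _ (Finset.mem_biUnion.2 ⟨e, Finset.mem_insert_self e A, hs.2⟩),
        Finset.card_insert_of_notMem he, mul_add, Finset.biUnion_insert]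
      have : ∑ i ∈ A.biUnion F, b i ≤ ∑ i ∈ F e ∪ A.biUnion F, b i :=
        Finset.sum_le_sum_of_subset Finset.subset_union_right
      omega
    · by_cases heB : e ∈ B
      · have hBA : B.erase e ⊂ A := by
          refine Finset.ssubset_iff_subset_ne.2 ⟨?_, fun h => hB.ne ?_⟩
          · have := Finset.erase_subset_erase e hB.1
            rwa [Finset.erase_insert he] at this
          · rw [← h, Finset.insert_erase heB]
        have h1 := hb3 _ hBA
        have h2 : ∑ i ∈ (B.erase e).biUnion F, b i ≤ ∑ i ∈ B.biUnion F, b i :=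
          Finset.sum_le_sum_of_subset (Finset.biUnion_subset_biUnion_of_subset_left _
            (Finset.erase_subset _ _))
        rw [hadd _ (Finset.mem_biUnion.2 ⟨e, heB, hs.2⟩), ← Finset.card_erase_add_one heB, mul_add]
        omega
      · have hBA : B ⊆ A := by
          have := Finset.erase_subset_erase e hB.1
          rwa [Finset.erase_insert he, Finset.erase_eq_of_notMem heB] at this
        -- For `B = A` the old vector is short by at most one, which the weight `k ≥ 1` at `s` makes
        -- up.
        rcases hBA.eq_or_ssubset with rfl | hBA
        · rw [hadd _ hsA]
          omega
        · exact (hb3 B hBA).trans (hle _)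

/-- Outside the union of `A` the exponent is `k * Fintype.card ι`, enough for any `B` reaching
there. Any other `B` lies in `A` by flatness, hence properly, and the deficient vector suffices. -/
theorem exists_deficient_exponent [Fintype σ] [Fintype ι] {F : ι → Finset σ}
    (hF : ∀ d, (F d).Nonempty) {k : ℕ} (hk : 1 ≤ k) {A : Finset ι} (hA : Linked F A)
    (hAf : Flat F A) : ∃ b : σ →₀ ℕ, ∑ i ∈ A.biUnion F, b i < k * A.card ∧
      ∀ B, Flat F B → B ≠ A → k * B.card ≤ ∑ i ∈ B.biUnion F, b i := by
  obtain ⟨b, hb1, -, hb3⟩ := hA.exists_deficient hF hk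
  refine ⟨Finsupp.equivFunOnFinite.symm fun i => if i ∈ A.biUnion F then b i else
    k * Fintype.card ι, ?_, fun B hB hBA => ?_⟩
  · refine lt_of_eq_of_lt (Finset.sum_congr rfl fun i hi => ?_)
      (lt_of_le_of_lt (Finset.sum_le_sum_of_subset (Finset.subset_univ (A.biUnion F))) hb1)
    simp only [Finsupp.equivFunOnFinite_symm_apply_apply, if_pos hi]
  · simp only [Finsupp.equivFunOnFinite_symm_apply_apply]
    by_cases hsub : B.biUnion F ⊆ A.biUnion F
    · have hss : B ⊂ A := Finset.ssubset_iff_subset_ne.2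
        ⟨fun d hd => hAf d ((Finset.subset_biUnion_of_mem F hd).trans hsub), hBA⟩
      refine (hb3 B hss).trans_eq (Finset.sum_congr rfl fun i hi => ?_)
      rw [if_pos (hsub hi)]
    · obtain ⟨i, hi, hiA⟩ := Finset.not_subset.1 hsub
      calc k * B.card ≤ k * Fintype.card ι := Nat.mul_le_mul_left k (Finset.card_le_univ B)
        _ = if i ∈ A.biUnion F then b i else k * Fintype.card ι := by rw [if_neg hiA]
        _ ≤ _ := Finset.single_le_sum
          (f := fun i => if i ∈ A.biUnion F then b i else k * Fintype.card ι)
          (fun _ _ => Nat.zero_le _) hi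

open Classical in
/-- The connected flat index sets of a finite family. -/
noncomputable def linkedFlats [Fintype ι] (F : ι → Finset σ) : Finset (Finset ι) :=
  Finset.univ.filter fun A => Linked F A ∧ Flat F A

theorem mem_linkedFlats [Fintype ι] {F : ι → Finset σ} {A : Finset ι} :
    A ∈ linkedFlats F ↔ Linked F A ∧ Flat F A := by
  classical
  simp [linkedFlats]

theorem varIdeal_biUnion_pow_injOn [Fintype ι] (F : ι → Finset σ) {k : ℕ} (hk : 1 ≤ k) :
    Set.InjOn (fun A : Finset ι => varIdeal K (A.biUnion F) ^ (k * A.card)) (linkedFlats F : Set (Finset ι)) := by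
  intro A hA B hB h
  rw [Finset.mem_coe, mem_linkedFlats] at hA hB
  have h' := congrArg Ideal.radical h
  simp only at h'
  rw [radical_varIdeal_pow _ (mul_ne_zero (by omega) hA.1.nonempty.card_ne_zero),
    radical_varIdeal_pow _ (mul_ne_zero (by omega) hB.1.nonempty.card_ne_zero)] at h'
  exact hA.2.eq_of_biUnion_eq hB.2 (varIdeal_injective h')

open Classical in
/-- The irredundant primary decomposition of a power of a product of ideals generated by
variables. -/
theorem isMinimalPrimaryDecomposition_prod_varIdeal_pow [Fintype σ] [Fintype ι]
    {F : ι → Finset σ} (hF : ∀ d, (F d).Nonempty) {k : ℕ} (hk : 1 ≤ k) :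
    Submodule.IsMinimalPrimaryDecomposition ((∏ d, varIdeal K (F d)) ^ k)
      ((linkedFlats F).image fun A => varIdeal K (A.biUnion F) ^ (k * A.card)) where
  inf_eq := by
    rw [Finset.inf_image, Function.id_comp]
    ext f
    simp only [Submodule.mem_finsetInf, mem_linkedFlats, mem_varIdeal_pow_iff]
    rw [mem_prod_varIdeal_pow_iff]
    constructor
    · intro h b hb
      exact hall_of_linked_flat hF k b fun A hA hA' => h A ⟨hA, hA'⟩ b hb
    · intro h A _ b hb
      exact h b hb A
  primary := by
    intro J hJ
    obtain ⟨A, hA, rfl⟩ := Finset.mem_image.1 hJ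
    rw [mem_linkedFlats] at hA
    exact isPrimary_varIdeal_pow _ (mul_ne_zero (by omega) hA.1.nonempty.card_ne_zero)
  distinct := by
    intro J hJ J' hJ' hne h
    obtain ⟨A, hA, rfl⟩ := Finset.mem_image.1 hJ
    obtain ⟨B, hB, rfl⟩ := Finset.mem_image.1 hJ'
    rw [mem_linkedFlats] at hA hB
    simp only [Submodule.colon_univ] at h
    rw [radical_varIdeal_pow _ (mul_ne_zero (by omega) hA.1.nonempty.card_ne_zero),
      radical_varIdeal_pow _ (mul_ne_zero (by omega) hB.1.nonempty.card_ne_zero)] at h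
    rw [hA.2.eq_of_biUnion_eq hB.2 (varIdeal_injective h)] at hne
    exact hne rfl
  minimal := by
    intro J hJ hle
    obtain ⟨A, hA, rfl⟩ := Finset.mem_image.1 hJ
    rw [mem_linkedFlats] at hA
    -- The monomial `x^b` lies in every other component but not in the one of `A`.
    obtain ⟨b, hb, hb'⟩ := exists_deficient_exponent hF hk hA.1 hA.2
    refine hb.not_ge ((monomial_mem_varIdeal_pow_iff (K := K) _ _ _).1 (hle ?_))
    rw [Submodule.mem_finsetInf]
    intro J hJ'
    obtain ⟨hne, hJ'⟩ := Finset.mem_erase.1 hJ'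
    obtain ⟨B, hB, rfl⟩ := Finset.mem_image.1 hJ'
    rw [mem_linkedFlats] at hB
    refine (monomial_mem_varIdeal_pow_iff _ _ _).2 (hb' B hB.2 fun hBA => hne ?_)
    rw [hBA]

/-- Annihilators of classes in `R ⧸ I` are colon ideals of `I`; this links `associatedPrimes` to the
notion used for primary decompositions. -/
theorem associatedPrimes_quotient {R : Type*} [CommRing R] (I : Ideal R) :
    associatedPrimes R (R ⧸ I) = Submodule.associatedPrimes I := by
  ext p
  have h : ∀ x : R, Submodule.colon (⊥ : Submodule R (R ⧸ I)) {Ideal.Quotient.mk I x} =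
      Submodule.colon I {x} := fun x => by
    ext r
    rw [Submodule.mem_colon_singleton, Submodule.mem_colon_singleton, Submodule.mem_bot,
      ← Ideal.Quotient.eq_zero_iff_mem]
    rfl
  rw [AssociatedPrimes.mem_iff, IsAssociatedPrime, Submodule.isAssociatedPrime_def,
    Submodule.AssociatePrimes.mem_iff, Submodule.isAssociatedPrime_def]
  refine and_congr_right fun _ => ⟨?_, ?_⟩
  · rintro ⟨x, hx⟩
    obtain ⟨x, rfl⟩ := Ideal.Quotient.mk_surjective x
    exact ⟨x, by rw [hx, h]⟩
  · rintro ⟨x, hx⟩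
    exact ⟨Ideal.Quotient.mk I x, by rw [hx, h]⟩

theorem associatedPrimes_prod_varIdeal [Fintype σ] [Fintype ι] {F : ι → Finset σ}
    (hF : ∀ d, (F d).Nonempty) :
    associatedPrimes (MvPolynomial σ K) (MvPolynomial σ K ⧸ ∏ d, varIdeal K (F d)) =
      (fun A => varIdeal K (A.biUnion F)) '' (linkedFlats F : Set (Finset ι)) := by
  classical
  have h := (isMinimalPrimaryDecomposition_prod_varIdeal_pow (K := K) hF
    le_rfl).image_radical_eq_associated_primes
  rw [pow_one] at h
  rw [associatedPrimes_quotient, ← h, Finset.coe_image, Set.image_image]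
  refine Set.image_congr fun A hA => ?_
  rw [Finset.mem_coe, mem_linkedFlats] at hA
  rw [Submodule.colon_univ, radical_varIdeal_pow _ (mul_ne_zero one_ne_zero
    hA.1.nonempty.card_ne_zero)]

end LinkedFamilies

end MixedProduct

/-! ### Maximal trees and connected flat sets. -/

namespace MixedProduct

open MvPolynomial

/-- Attaching a leaf to a subtree of a finite graph gives a subtree. -/
theorem isTree_sup_subgraphOfAdj {V : Type*} [Finite V] {G : SimpleGraph V} {H : G.Subgraph}
    (hH : H.coe.IsTree) {d e : V} (hd : d ∈ H.verts) (he : e ∉ H.verts) (hde : G.Adj d e) :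
    (H ⊔ G.subgraphOfAdj hde).coe.IsTree := by
  have hcard : ∀ H' : G.Subgraph, Nat.card H'.coe.edgeSet = H'.edgeSet.ncard := fun H' => by
    rw [← H'.image_coe_edgeSet_coe,
      Set.ncard_image_of_injective _ (Sym2.map.injective Subtype.val_injective),
      Nat.card_coe_set_eq]
  -- A leaf adds one vertex and one edge, preserving the tree count.
  rw [SimpleGraph.isTree_iff_connected_and_card, hcard, Nat.card_coe_set_eq] at hH ⊢
  refine ⟨(SimpleGraph.Subgraph.connected_sup
    (SimpleGraph.Subgraph.Connected.mk hH.1).preconnected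
    (SimpleGraph.Subgraph.subgraphOfAdj_connected hde).preconnected ⟨d, hd, by simp⟩).coe, ?_⟩
  have hv : (H ⊔ G.subgraphOfAdj hde).verts = insert e H.verts := by
    ext x
    simp only [SimpleGraph.Subgraph.verts_sup, SimpleGraph.subgraphOfAdj_verts, Set.mem_union,
      Set.mem_insert_iff, Set.mem_singleton_iff]
    constructor
    · rintro (h | rfl | rfl) <;> tauto
    · tauto
  have hedge : s(d, e) ∉ H.edgeSet := fun h => he (H.edge_vert (H.adj_symm h))
  rw [hv, Set.ncard_insert_of_notMem he, SimpleGraph.Subgraph.edgeSet_sup,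
    SimpleGraph.edgeSet_subgraphOfAdj, Set.union_singleton, Set.ncard_insert_of_notMem hedge, hH.2]

section Subgraphs

variable {K : Type*} [Field K] {n r : ℕ} {F : Fin r → Finset (Fin n)}

theorem Linked.exists_isTree {A : Finset (Fin r)} (hA : Linked F A) :
    ∃ H : (intersectionGraph F).Subgraph, H.verts = A ∧ H.coe.IsTree := by
  induction hA with
  | singleton d =>
    exact ⟨(intersectionGraph F).singletonSubgraph d, by simp,
      SimpleGraph.IsTree.coe_singletonSubgraph _ d⟩
  | @adjoin A d e _ he hd hde ih =>
    obtain ⟨H, hHA, hH⟩ := ih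
    have hadj : (intersectionGraph F).Adj d e := ⟨fun h => he (h ▸ hd), hde⟩
    refine ⟨H ⊔ (intersectionGraph F).subgraphOfAdj hadj, ?_,
      isTree_sup_subgraphOfAdj hH (by simpa [hHA] using hd) (by simpa [hHA] using he) hadj⟩
    rw [SimpleGraph.Subgraph.verts_sup, hHA, SimpleGraph.subgraphOfAdj_verts, Finset.coe_insert]
    ext x
    simp only [Set.mem_union, Set.mem_insert_iff, Set.mem_singleton_iff, Finset.mem_coe]
    constructor
    · rintro (h | rfl | rfl) <;> tauto
    · tauto

theorem primeOfSubgraph_eq (H : (intersectionGraph F).Subgraph) {A : Finset (Fin r)}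
    (hA : H.verts = A) : primeOfSubgraph K H = varIdeal K (A.biUnion F) := by
  rw [varIdeal_biUnion, primeOfSubgraph, hA]
  rfl

theorem primeOf'_eq (m : Fin n → ℕ) (U : Finset (Fin n)) :
    primeOf' K m U = varIdeal K (U.sigma fun i => (Finset.univ : Finset (Fin (m i)))) := by
  have h : (U.sigma fun i => (Finset.univ : Finset (Fin (m i)))) =
      U.biUnion fun i => Finset.univ.map (Function.Embedding.sigmaMk i) := by
    ext ⟨i, j⟩
    simp only [Finset.mem_sigma, Finset.mem_univ, and_true, Finset.mem_biUnion, Finset.mem_map,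
      true_and, Function.Embedding.sigmaMk_apply]
    constructor
    · exact fun hi => ⟨i, hi, j, rfl⟩
    · rintro ⟨i', hi', j', h⟩
      obtain rfl : i' = i := congrArg Sigma.fst h
      exact hi'
  rw [h, varIdeal_biUnion, primeOf']
  refine iSup_congr fun i => iSup_congr fun _ => ?_
  rw [varIdeal, blockIdeal]
  congr 1
  ext f
  simp

theorem primeOfSubgraph'_eq (m : Fin n → ℕ) (H : (intersectionGraph F).Subgraph)
    {A : Finset (Fin r)} (hA : H.verts = A) : primeOfSubgraph' K m H =
      varIdeal K (A.biUnion fun d => (F d).sigma fun i => (Finset.univ : Finset (Fin (m i)))) := by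
  rw [varIdeal_biUnion, primeOfSubgraph', hA]
  exact iSup_congr fun d => iSup_congr fun _ => primeOf'_eq m (F d)

theorem exists_isMaximalTreeFor {A : Finset (Fin r)} (hA : Linked F A) :
    ∃ H : (intersectionGraph F).Subgraph, IsMaximalTreeFor (varIdeal K (A.biUnion F)) H := by
  obtain ⟨H, hHA, hH⟩ := hA.exists_isTree
  obtain ⟨H', -, hH'⟩ := (Set.toFinite {H' : (intersectionGraph F).Subgraph |
    H'.coe.IsTree ∧ primeOfSubgraph K H' = varIdeal K (A.biUnion F)}).exists_le_maximal
    (a := H) ⟨hH, primeOfSubgraph_eq H hHA⟩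
  exact ⟨H', hH'⟩

/-- Flatness bounds the vertices by `A`. An index of `A` off the tree is covered by the tree's
union, so it attaches as a leaf without changing the ideal, against maximality. -/
theorem IsMaximalTreeFor.verts_eq (hF : ∀ d, (F d).Nonempty) {A : Finset (Fin r)} (hA : Flat F A)
    {H : (intersectionGraph F).Subgraph} (hH : IsMaximalTreeFor (varIdeal K (A.biUnion F)) H) :
    H.verts = A := by
  obtain ⟨B, hB⟩ := H.verts.toFinite.exists_finset_coe
  obtain ⟨hHt, hHP⟩ := hH.prop
  have hBA : B.biUnion F = A.biUnion F := by
    rw [primeOfSubgraph_eq H hB.symm] at hHP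
    exact varIdeal_injective hHP
  rw [← hB, Finset.coe_inj]
  refine Finset.Subset.antisymm
    (fun d hd => hA d (hBA ▸ Finset.subset_biUnion_of_mem F hd)) fun e he => ?_
  by_contra heB
  have heF : F e ⊆ B.biUnion F := hBA ▸ Finset.subset_biUnion_of_mem F he
  obtain ⟨i, hi⟩ := hF e
  obtain ⟨d, hd, hid⟩ := Finset.mem_biUnion.1 (heF hi)
  have hadj : (intersectionGraph F).Adj d e :=
    ⟨fun h => heB (h ▸ hd), i, Finset.mem_inter.2 ⟨hid, hi⟩⟩
  have hdH : d ∈ H.verts := by rw [← hB]; exact hd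
  have heH : e ∉ H.verts := by rw [← hB]; exact heB
  have hverts : (H ⊔ (intersectionGraph F).subgraphOfAdj hadj).verts =
      (insert e B : Finset (Fin r)) := by
    rw [SimpleGraph.Subgraph.verts_sup, ← hB, SimpleGraph.subgraphOfAdj_verts, Finset.coe_insert]
    ext x
    simp only [Set.mem_union, Set.mem_insert_iff, Set.mem_singleton_iff, Finset.mem_coe]
    constructor
    · rintro (h | rfl | rfl) <;> tauto
    · tauto
  have hle := hH.le_of_ge (y := H ⊔ (intersectionGraph F).subgraphOfAdj hadj)
    ⟨isTree_sup_subgraphOfAdj hHt hdH heH hadj, by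
      rw [primeOfSubgraph_eq _ hverts, Finset.biUnion_insert, Finset.union_eq_right.2 heF, hBA]⟩
    le_sup_left
  exact heH (hle.1 (by rw [hverts]; simp))

end Subgraphs

/-! ### The induced ideal as a product over the blown-up sets. -/

section MixedProducts

variable {K : Type*} [Field K] {n r : ℕ}

theorem mem_minGenExponents_transversalIdeal_iff (F : Fin r → Finset (Fin n)) (a : Fin n →₀ ℕ) :
    a ∈ minGenExponents (transversalIdeal K F) ↔
      ∃ c : Fin r → Fin n, (∀ d, c d ∈ F d) ∧ ∑ d, Finsupp.single (c d) 1 = a := by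
  have hmem : ∀ b : Fin n →₀ ℕ, monomial b (1 : K) ∈ transversalIdeal K F ↔
      ∃ c : Fin r → Fin n, (∀ d, c d ∈ F d) ∧ ∑ d, Finsupp.single (c d) 1 ≤ b := fun b => by
    have h : transversalIdeal K F = ∏ d, varIdeal K (F d) := rfl
    classical
    rw [h, mem_prod_varIdeal_iff, support_monomial, if_neg one_ne_zero, exists_sum_single_le_iff]
    simp
  simp only [minGenExponents, hmem, Set.mem_ofPred_eq]
  constructor
  · rintro ⟨⟨c, hc, hca⟩, hmin⟩
    exact ⟨c, hc, le_antisymm hca (hmin ⟨c, hc, le_rfl⟩ hca)⟩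
  · rintro ⟨c, hc, rfl⟩
    refine ⟨⟨c, hc, le_rfl⟩, ?_⟩
    rintro b ⟨c', -, hb⟩ hbc
    -- All these exponents have degree `r`, so comparable ones are equal and each is minimal.
    have hdeg : ∀ f : Fin r → Fin n, (∑ d, Finsupp.single (f d) 1 : Fin n →₀ ℕ).degree = r :=
      fun f => by simp [map_sum]
    have heq : ∑ d, Finsupp.single (c' d) 1 = (∑ d, Finsupp.single (c d) 1 : Fin n →₀ ℕ) := by
      obtain ⟨u, hu⟩ := exists_add_of_le (hb.trans hbc)
      have h := congrArg Finsupp.degree hu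
      rw [map_add, hdeg, hdeg] at h
      have hu0 : u = 0 := (Finsupp.degree_eq_zero_iff u).1 (by omega)
      rw [hu, hu0, add_zero]
    exact heq ▸ hb

/-- Distributing the product over the sums gives one term per choice function `c`, and these yield
exactly the minimal generators of `I`. -/
theorem mixedProductIdeal_transversalIdeal (F : Fin r → Finset (Fin n)) (m : Fin n → ℕ)
    (L : Fin n → ℕ → Ideal (BlockRing K m)) (hL : ∀ i a, L i a = blockIdeal K m i ^ a) :
    mixedProductIdeal (transversalIdeal K F) L = ∏ d, primeOf' K m (F d) := by
  have h1 : ∀ d, primeOf' K m (F d) = ∑ i ∈ F d, blockIdeal K m i := fun d => by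
    rw [Ideal.sum_eq_sup, Finset.sup_eq_iSup, primeOf']
  have h2 : ∀ c : Fin r → Fin n,
      ∏ i, L i ((∑ d, Finsupp.single (c d) 1 : Fin n →₀ ℕ) i) = ∏ d, blockIdeal K m (c d) :=
    fun c => by
      simp only [hL, Finsupp.finsetSum_apply, ← Finset.prod_pow_eq_pow_sum]
      rw [Finset.prod_comm]
      refine Finset.prod_congr rfl fun d _ => ?_
      rw [Finset.prod_eq_single (c d)]
      · simp
      · intro i _ hi
        rw [Finsupp.single_apply, if_neg hi.symm, pow_zero]
      · simp
  simp only [h1]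
  rw [Finset.prod_univ_sum, Ideal.sum_eq_sup, Finset.sup_eq_iSup, mixedProductIdeal]
  refine le_antisymm (iSup₂_le fun a ha => ?_) (iSup₂_le fun c hc => ?_)
  · obtain ⟨c, hc, rfl⟩ := (mem_minGenExponents_transversalIdeal_iff F a).1 ha
    rw [h2]
    exact le_iSup₂_of_le c (Fintype.mem_piFinset.2 hc) le_rfl
  · rw [← h2]
    have hmem := (mem_minGenExponents_transversalIdeal_iff (K := K) F _).2
      ⟨c, Fintype.mem_piFinset.1 hc, rfl⟩
    exact le_iSup₂ (f := fun a (_ : a ∈ minGenExponents (transversalIdeal K F)) =>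
      ∏ i, L i (a i)) (∑ d, Finsupp.single (c d) 1) hmem

/-- As every block is non-empty, blowing up preserves and reflects intersections and coverings. -/
theorem linkedFlats_sigma (F : Fin r → Finset (Fin n)) {m : Fin n → ℕ} (hm : ∀ i, 1 ≤ m i) :
    linkedFlats (fun d => (F d).sigma fun i => (Finset.univ : Finset (Fin (m i)))) =
      linkedFlats F := by
  have hmeet : ∀ d e, ((F d).sigma (fun i => (Finset.univ : Finset (Fin (m i)))) ∩
      (F e).sigma fun i => (Finset.univ : Finset (Fin (m i)))).Nonempty ↔
        (F d ∩ F e).Nonempty := fun d e => by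
    constructor
    · rintro ⟨⟨i, j⟩, h⟩
      simp only [Finset.mem_inter, Finset.mem_sigma, Finset.mem_univ, and_true] at h
      exact ⟨i, Finset.mem_inter.2 h⟩
    · rintro ⟨i, h⟩
      exact ⟨⟨i, ⟨0, hm i⟩⟩, by simpa using h⟩
  have hsub : ∀ d (A : Finset (Fin r)), (F d).sigma (fun i => (Finset.univ : Finset (Fin (m i)))) ⊆
      (A.biUnion fun d => (F d).sigma fun i => (Finset.univ : Finset (Fin (m i)))) ↔
        F d ⊆ A.biUnion F := fun d A => by
    constructor
    · intro h i hi
      simpa using h (show (⟨i, ⟨0, hm i⟩⟩ : Σ i, Fin (m i)) ∈ _ by simpa using hi)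
    · rintro h ⟨i, j⟩ hi
      simpa using h (Finset.mem_sigma.1 hi).1
  ext A
  simp only [mem_linkedFlats, Flat, hsub]
  exact and_congr_left fun _ => ⟨fun h => h.mono fun d e => (hmeet d e).1,
    fun h => h.mono fun d e => (hmeet d e).2⟩

end MixedProducts

end MixedProduct


open MixedProduct in
theorem mainTheorem5 {K : Type*} [Field K] {n r : ℕ} (hr : 1 ≤ r)
    (F : Fin r → Finset (Fin n)) (hF : ∀ d, (F d).Nonempty)
    (m : Fin n → ℕ) (hm : ∀ i, 1 ≤ m i)
    (L : Fin n → ℕ → Ideal (MixedProduct.BlockRing K m))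
    (hL0 : ∀ i, L i 0 = ⊤)
    (hL1 : ∀ i, L i 1 = MixedProduct.blockIdeal K m i)
    (hLmul : ∀ i a b, L i (a + b) = L i a * L i b)
    {q : ℕ} (P : Fin q → Ideal (MixedProduct.BaseRing K n)) (hPinj : Function.Injective P)
    (hP : Set.range P = associatedPrimes (MixedProduct.BaseRing K n)
      (MixedProduct.BaseRing K n ⧸ MixedProduct.transversalIdeal K F)) :
    (∀ h, ∃ H : (MixedProduct.intersectionGraph F).Subgraph,
      MixedProduct.IsMaximalTreeFor (P h) H) ∧
    ∀ t : Fin q → (MixedProduct.intersectionGraph F).Subgraph,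
      (∀ h, MixedProduct.IsMaximalTreeFor (P h) (t h)) →
      ∀ k : ℕ, 1 ≤ k →
        MixedProduct.IsIrredundantPrimaryDecomposition
          (MixedProduct.mixedProductIdeal (MixedProduct.transversalIdeal K F) L ^ k)
          (fun h => MixedProduct.primeOfSubgraph' K m (t h) ^ (k * (t h).verts.ncard)) := by
  have hL : ∀ i a, L i a = blockIdeal K m i ^ a := fun i a => by
    induction a with
    | zero => rw [hL0, pow_zero, Ideal.one_eq_top]
    | succ a ih => rw [hLmul, ih, hL1, pow_succ]
  have hP' : Set.range P = (fun A : Finset (Fin r) => varIdeal K (A.biUnion F)) ''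
      (linkedFlats F : Set (Finset (Fin r))) :=
    hP.trans (associatedPrimes_prod_varIdeal hF)
  have hA : ∀ h, ∃ A ∈ linkedFlats F, varIdeal K (A.biUnion F) = P h := fun h => by
    have := Set.mem_range_self (f := P) h
    rwa [hP'] at this
  choose A hAF hAP using hA
  have hAinj : Function.Injective A := fun h h' hh => hPinj (by rw [← hAP, ← hAP, hh])
  have hAsurj : ∀ B ∈ linkedFlats F, ∃ h, A h = B := fun B hB => by
    obtain ⟨h, hh⟩ : varIdeal K (B.biUnion F) ∈ Set.range P := hP' ▸ ⟨B, hB, rfl⟩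
    refine ⟨h, (mem_linkedFlats.1 (hAF h)).2.eq_of_biUnion_eq (mem_linkedFlats.1 hB).2 ?_⟩
    exact varIdeal_injective ((hAP h).trans hh)
  refine ⟨fun h => hAP h ▸ exists_isMaximalTreeFor (mem_linkedFlats.1 (hAF h)).1,
    fun t ht k hk => ?_⟩
  set F' : Fin r → Finset (Σ i : Fin n, Fin (m i)) :=
    fun d => (F d).sigma fun i => (Finset.univ : Finset (Fin (m i))) with hF'
  have hF'ne : ∀ d, (F' d).Nonempty := fun d => by
    obtain ⟨i, hi⟩ := hF d
    exact ⟨⟨i, ⟨0, hm i⟩⟩, by simpa [hF'] using hi⟩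
  have hAF' : linkedFlats F' = linkedFlats F := linkedFlats_sigma F hm
  have hQ : ∀ h, primeOfSubgraph' K m (t h) ^ (k * (t h).verts.ncard) =
      varIdeal K ((A h).biUnion F') ^ (k * (A h).card) := fun h => by
    have hv := IsMaximalTreeFor.verts_eq hF (mem_linkedFlats.1 (hAF h)).2
      ((hAP h).symm ▸ ht h)
    rw [primeOfSubgraph'_eq m (t h) hv, hv, Set.ncard_coe_finset]
  have hJ : mixedProductIdeal (transversalIdeal K F) L = ∏ d, varIdeal K (F' d) := by
    rw [mixedProductIdeal_transversalIdeal F m L hL]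
    exact Finset.prod_congr rfl fun d _ => primeOf'_eq m (F d)
  classical
  -- The map `h ↦ A h` is a bijection onto the connected flat sets, so the two families of
  -- components agree.
  have himage : Finset.univ.image
      (fun h => varIdeal K ((A h).biUnion F') ^ (k * (A h).card)) =
      (linkedFlats F').image fun B => varIdeal K (B.biUnion F') ^ (k * B.card) := by
    ext J
    simp only [Finset.mem_image, Finset.mem_univ, true_and, hAF']
    constructor
    · rintro ⟨h, rfl⟩
      exact ⟨A h, hAF h, rfl⟩
    · rintro ⟨B, hB, rfl⟩
      obtain ⟨h, rfl⟩ := hAsurj B hB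
      exact ⟨h, rfl⟩
  have hmin := isMinimalPrimaryDecomposition_prod_varIdeal_pow (K := K) hF'ne hk
  rw [← himage] at hmin
  simp only [hQ, hJ]
  refine ⟨?_, fun h h' hh => hAinj (varIdeal_biUnion_pow_injOn F' hk
    (by rw [hAF']; exact hAF h) (by rw [hAF']; exact hAF h') hh), ?_⟩
  · rw [← hmin.inf_eq, Finset.inf_image, Function.id_comp, Finset.inf_univ_eq_iInf]
  · exact hmin
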